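/- **Setting.** Let $n\ge 1$. A critical radius function is a positive continuous function $\rho$ on $\mathbb R^n$ for which there are $C_0,k_0\ge 1$ with $$C_0^{-1}\rho(x)\Bigl(1+\tfrac{|x-y|}{\rho(x)}\Bigr)^{-k_0}\le\rho(y)\le C_0\,\rho(x)\Bigl(1+\tfrac{|x-y|}{\rho(x)}\Bigr)^{k_0/(k_0+1)}\qquad(x,y\in\mathbb R^n).$$ For a ball $B=B(z,r)$ and $\theta\ge0$ put $\Psi_\theta(B)=(1+r/\rho(z))^\theta$. A weight is an (almost everywhere) positive locally integrable function $\omega$ on $\mathbb R^n$. For $1<q<\infty$, $\omega\in A_q^{\rho,\theta}$ means that for some constant $C$ and all balls $B$ $$\Bigl(\tfrac1{\Psi_\theta(B)|B|}\int_B\omega\Bigr)\Bigl(\tfrac1{\Psi_\theta(B)|B|}\int_B\omega^{-1/(q-1)}\Bigr)^{q-1}\le C,$$ and $\omega\in A_1^{\rho,\theta}$ means that for some constant $C$, $\sup_{B\ni x}\frac1{\Psi_\theta(B)|B|}\int_B\omega\le C\omega(x)$ for almost every $x$. Let $A_q^{\rho,\infty}=\bigcup_{\theta\ge0}A_q^{\rho,\theta}$,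 $A_\infty^{\rho,\infty}=\bigcup_{1\le q<\infty}A_q^{\rho,\infty}$ and, for $\omega\in A_\infty^{\rho,\infty}$, $q_\omega=\inf\{q\in[1,\infty):\omega\in A_q^{\rho,\infty}\}$. Let $\mathcal D(\mathbb R^n)=C_0^\infty(\mathbb R^n)$ (complex-valued), and let $\mathcal D'(\mathbb R^n)$ be its dual. Write $\varphi_l(x)=2^{ln}\varphi(2^lx)$ for $l\in\mathbb Z$. For $N\in\mathbb N$ and $R>1$ let $\mathcal D_{N,R}$ be the set of $\varphi\in\mathcal D(\mathbb R^n)$ with $\operatorname{supp}\varphi\subset B(0,R)$ and $\sup_x|\partial^\alpha\varphi(x)|\le1$ for all $|\alpha|\le N$. For $f\in\mathcal D'(\mathbb R^n)$ let $$\mathcal M_N(f)(x)=\sup\{|\varphi_l*f(x)|:\ l\in\mathbb Z,\ 0<2^{-l}<\rho(x),\ \varphi\in\mathcal D_{N,R}\}.$$ For $p\in(0,1]$ let $$h^p_{\rho,N}(\omega)=\{f\in\mathcal D'(\mathbb R^n):\mathcal M_N(f)\in L^p_\omega(\mathbb R^n)\},\qquad \|f\|_{h^p_{\rho,N}(\omega)}=\Bigl(\int_{\mathbb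 R^n}\mathcal M_N(f)(x)^p\,\omega(x)\,dx\Bigr)^{1/p}.$$ Finally, with $[\cdot]$ the integer part and $A_0\in\mathbb R$, put $$N_{p,\omega}=\max\Bigl\{\bigl[n(\tfrac{q_\omega}p-1)\bigr]+2,\ \bigl[2\max\{A_0,\tfrac{nq_\omega}p\}\bigr]+1\Bigr\}.$$ **Proposition 3.3.** Let $\rho$ be a critical radius function on $\mathbb R^n$, $\omega\in A_\infty^{\rho,\infty}$, $p\in(0,1]$, $R>1$ and $A_0\in\mathbb R$. For every integer $N\ge N_{p,\omega}$ the space $h^p_{\rho,N}(\omega)$ is complete: if $f_j\in h^p_{\rho,N}(\omega)$ and $\|f_i-f_j\|_{h^p_{\rho,N}(\omega)}\to0$ as $i,j\to\infty$, then there is $g\in h^p_{\rho,N}(\omega)$ with $\|f_j-g\|_{h^p_{\rho,N}(\omega)}\to0$ as $j\to\infty$. -/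

import Mathlib

open MeasureTheory Filter Topology
open scoped ENNReal NNReal Distributions

noncomputable section

namespace WeightedLocalHardy

/-- The Euclidean space `ℝⁿ`. -/
abbrev E (n : ℕ) : Type := EuclideanSpace ℝ (Fin n)

/-- `𝒟(ℝⁿ)`: complex-valued smooth compactly supported functions, with the usual (LF) topology. -/
abbrev TestFn (n : ℕ) : Type := 𝓓((⊤ : TopologicalSpace.Opens (E n)), ℂ)

/-- `𝒟'(ℝⁿ)`: the continuous complex-linear functionals on `𝒟(ℝⁿ)`. -/
abbrev Distr (n : ℕ) : Type := TestFn n →L[ℂ] ℂ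

/-! ### Critical radius functions and weight classes -/

/-- A critical radius function: a positive continuous function `ρ` on `ℝⁿ` for which there are
`C₀ ≥ 1`, `k₀ ≥ 1` with
`C₀⁻¹ ρ(x) (1 + |x-y|/ρ(x))^{-k₀} ≤ ρ(y) ≤ C₀ ρ(x) (1 + |x-y|/ρ(x))^{k₀/(k₀+1)}` for all `x, y`. -/
structure IsCriticalRadius {n : ℕ} (ρ : E n → ℝ) : Prop where
  pos : ∀ x, 0 < ρ x
  continuous : Continuous ρ
  slowly_varying : ∃ C₀ k₀ : ℝ, 1 ≤ C₀ ∧ 1 ≤ k₀ ∧ ∀ x y : E n,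
    C₀⁻¹ * ρ x * (1 + ‖x - y‖ / ρ x) ^ (-k₀) ≤ ρ y ∧
      ρ y ≤ C₀ * ρ x * (1 + ‖x - y‖ / ρ x) ^ (k₀ / (k₀ + 1))

/-- A weight: an almost everywhere positive, locally integrable function. -/
structure IsWeight {n : ℕ} (ω : E n → ℝ) : Prop where
  pos : ∀ᵐ x ∂(volume : Measure (E n)), 0 < ω x
  locallyIntegrable : LocallyIntegrable ω (volume : Measure (E n))

/-- `Ψ_θ(B) |B|` for the ball `B = B(z, r)`, where `Ψ_θ(B) = (1 + r/ρ(z))^θ`. -/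
def psiVol {n : ℕ} (ρ : E n → ℝ) (θ : ℝ) (z : E n) (r : ℝ) : ℝ≥0∞ :=
  ENNReal.ofReal ((1 + r / ρ z) ^ θ) * volume (Metric.ball z r)

/-- `(Ψ_θ(B) |B|)⁻¹ ∫_B g` for the ball `B = B(z, r)` and a nonnegative function `g`. -/
def psiAvg {n : ℕ} (ρ : E n → ℝ) (θ : ℝ) (g : E n → ℝ≥0∞) (z : E n) (r : ℝ) : ℝ≥0∞ :=
  (∫⁻ y in Metric.ball z r, g y) / psiVol ρ θ z r

/-- The maximal function `M_{V,θ} g (x) = sup_{B ∋ x} (Ψ_θ(B) |B|)⁻¹ ∫_B g`, for `g ≥ 0`. -/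
def psiMaximal {n : ℕ} (ρ : E n → ℝ) (θ : ℝ) (g : E n → ℝ≥0∞) (x : E n) : ℝ≥0∞ :=
  ⨆ (z : E n) (r : ℝ) (_ : x ∈ Metric.ball z r), psiAvg ρ θ g z r

/-- The class `A_1^{ρ,θ}`. -/
def MemA1 {n : ℕ} (ρ : E n → ℝ) (θ : ℝ) (ω : E n → ℝ) : Prop :=
  IsWeight ω ∧ ∃ C : ℝ≥0, ∀ᵐ x ∂(volume : Measure (E n)),
    psiMaximal ρ θ (fun y => ENNReal.ofReal (ω y)) x ≤ C * ENNReal.ofReal (ω x)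

/-- The class `A_p^{ρ,θ}` for `1 < p < ∞`. -/
def MemApOfOneLt {n : ℕ} (ρ : E n → ℝ) (p θ : ℝ) (ω : E n → ℝ) : Prop :=
  IsWeight ω ∧ ∃ C : ℝ≥0, ∀ (z : E n) (r : ℝ), 0 < r →
    psiAvg ρ θ (fun y => ENNReal.ofReal (ω y)) z r *
      (psiAvg ρ θ (fun y => ENNReal.ofReal (ω y) ^ (-1 / (p - 1))) z r) ^ (p - 1) ≤ C

/-- The class `A_p^{ρ,∞} = ⋃_{θ ≥ 0} A_p^{ρ,θ}`, for `1 ≤ p < ∞`. -/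
def MemAp {n : ℕ} (ρ : E n → ℝ) (p : ℝ) (ω : E n → ℝ) : Prop :=
  ∃ θ : ℝ, 0 ≤ θ ∧ ((p = 1 ∧ MemA1 ρ θ ω) ∨ (1 < p ∧ MemApOfOneLt ρ p θ ω))

/-- The class `A_∞^{ρ,∞} = ⋃_{1 ≤ p < ∞} A_p^{ρ,∞}`. -/
def MemAInfty {n : ℕ} (ρ : E n → ℝ) (ω : E n → ℝ) : Prop :=
  ∃ p : ℝ, 1 ≤ p ∧ MemAp ρ p ω

/-- The critical index `q_ω = inf {p ∈ [1, ∞) : ω ∈ A_p^{ρ,∞}}`. -/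
def criticalIndex {n : ℕ} (ρ : E n → ℝ) (ω : E n → ℝ) : ℝ :=
  sInf {p : ℝ | 1 ≤ p ∧ MemAp ρ p ω}

/-! ### The local vertical grand maximal function -/

/-- The class `𝒟_{N,R}`: test functions supported in `B(0, R)` all of whose partial derivatives
`∂_{s_1} ⋯ ∂_{s_k} φ` of order `k ≤ N` are bounded by `1` in absolute value. -/
def testClass (n N : ℕ) (R : ℝ) : Set (TestFn n) :=
  {φ | tsupport (φ : E n → ℂ) ⊆ Metric.ball 0 R ∧
    ∀ (k : ℕ), k ≤ N → ∀ (s : Fin k → Fin n) (x : E n),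
      ‖iteratedFDeriv ℝ k (φ : E n → ℂ) x (fun i => EuclideanSpace.single (s i) (1 : ℝ))‖ ≤ 1}

/-- The test function `y ↦ φ_l(x - y)`, where `φ_l(z) = 2^{ln} φ(2^l z)`. -/
def dilateReflect {n : ℕ} (φ : TestFn n) (l : ℤ) (x : E n) : TestFn n where
  toFun y := ((2 : ℝ) ^ (l * n) : ℝ) • φ ((2 : ℝ) ^ l • (x - y))
  contDiff' := by
    have h1 : ContDiff ℝ ((⊤ : ℕ∞) : WithTop ℕ∞) (fun y : E n => (2 : ℝ) ^ l • (x - y)) :=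
      (contDiff_const.sub contDiff_id).const_smul ((2 : ℝ) ^ l)
    exact (φ.contDiff.comp h1).const_smul ((2 : ℝ) ^ (l * n) : ℝ)
  hasCompactSupport' := by
    have h2 : (2 : ℝ) ^ l ≠ 0 := zpow_ne_zero _ two_ne_zero
    have h := φ.hasCompactSupport.comp_homeomorph
      ((Homeomorph.subLeft x).trans (Homeomorph.smulOfNeZero ((2 : ℝ) ^ l) h2))
    exact h.smul_left (f := fun _ => ((2 : ℝ) ^ (l * n) : ℝ))
  tsupport_subset' := fun _ _ => trivial

/-- The convolution `(φ_l ∗ f)(x) = ⟨f, φ_l(x - ·)⟩`. -/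
def convAt {n : ℕ} (f : Distr n) (φ : TestFn n) (l : ℤ) (x : E n) : ℂ :=
  f (dilateReflect φ l x)

/-- The local vertical grand maximal function
`M_{N,R}(f)(x) = sup {|φ_l ∗ f(x)| : l ∈ ℤ, 0 < 2^{-l} < ρ(x), φ ∈ 𝒟_{N,R}}`. -/
def grandMaximal {n : ℕ} (ρ : E n → ℝ) (N : ℕ) (R : ℝ) (f : Distr n) (x : E n) : ℝ≥0∞ :=
  ⨆ (l : ℤ) (_ : (2 : ℝ) ^ (-l) < ρ x) (φ : TestFn n) (_ : φ ∈ testClass n N R), ‖convAt f φ l x‖ₑ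

/-! ### The weighted local Hardy space -/

/-- `‖g‖_{L^p_ω} = (∫ g^p ω dx)^{1/p}`, for `g ≥ 0`. -/
def weightedLpNorm {n : ℕ} (ω : E n → ℝ) (p : ℝ) (g : E n → ℝ≥0∞) : ℝ≥0∞ :=
  (∫⁻ x, g x ^ p * ENNReal.ofReal (ω x)) ^ (1 / p)

/-- The quasi-norm `‖f‖_{h^p_{ρ,N}(ω)} = ‖M_{N,R}(f)‖_{L^p_ω}`. -/
def hardyNorm {n : ℕ} (ρ ω : E n → ℝ) (p : ℝ) (N : ℕ) (R : ℝ) (f : Distr n) : ℝ≥0∞ :=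
  weightedLpNorm ω p (grandMaximal ρ N R f)

/-- The space `h^p_{ρ,N}(ω)` of the distributions `f` with `M_{N,R}(f) ∈ L^p_ω`, that is, with
`M_{N,R}(f)` measurable and `‖M_{N,R}(f)‖_{L^p_ω} < ∞`. -/
def hardySpace {n : ℕ} (ρ ω : E n → ℝ) (p : ℝ) (N : ℕ) (R : ℝ) : Set (Distr n) :=
  {f | AEMeasurable (grandMaximal ρ N R f) ∧ hardyNorm ρ ω p N R f < ∞}

/-- `Ñ_{p,ω} = [n (q_ω/p - 1)] + 2`. -/
def orderTilde {n : ℕ} (ρ ω : E n → ℝ) (p : ℝ) : ℤ :=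
  ⌊(n : ℝ) * (criticalIndex ρ ω / p - 1)⌋ + 2

/-- `N_{p,ω} = max {Ñ_{p,ω}, N₀}`, where `N₀ = [2 A₁] + 1` and `A₁ = max {A₀, n q_ω/p}`,
as a function of the auxiliary constant `A₀` (any real number; nothing is assumed of it). -/
def orderThreshold {n : ℕ} (ρ ω : E n → ℝ) (p A₀ : ℝ) : ℤ :=
  max (orderTilde ρ ω p) (⌊2 * max A₀ ((n : ℝ) * criticalIndex ρ ω / p)⌋ + 1)

end WeightedLocalHardy

end

namespace WeightedLocalHardy

open Metric TopologicalSpace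

variable {n : ℕ}

/-! The Hardy quasi-norm controls convergence of distributions. Near a point `a`, `ρ` exceeds some
fixed `2^{-l}`, so a test function `φ` supported in a small ball about `a` is, up to a factor
bounded by its derivatives of order at most `N`, of the form `ψ_l(x - ·)` with `ψ ∈ 𝒟_{N,R}`, for
every `x` in that ball. Hence `|f(φ)| ≤ C M_N f(x)` throughout the ball
(`enorm_apply_le_grandMaximal`). Averaging against `ω`, whose mass on a ball is positive and finite,
replaces the right side by the Hardy quasi-norm of `f` (`exists_local_bound`), and a partition of
unity extends this to all compact supports (`exists_continuous_bound`).

A Cauchy sequence therefore converges pointwise on `𝒟` to a distribution `g`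
(`exists_tendsto_distr`). Since `M_N` is lower semicontinuous under such convergence, Fatou's lemma
bounds the quasi-norm of a limit (`hardyNorm_le_of_tendsto`); this gives both the membership of `g`
and convergence to it. -/

/-! ### Dilated and reflected test functions -/

theorem dilateReflect_apply (φ : TestFn n) (l : ℤ) (x y : E n) :
    dilateReflect φ l x y = ((2 : ℝ) ^ (l * n) : ℝ) • φ ((2 : ℝ) ^ l • (x - y)) := rfl

theorem dilateReflect_eq_translate (φ : TestFn n) (l : ℤ) (x : E n) :
    (dilateReflect φ l x : E n → ℂ) = fun y => dilateReflect φ l 0 (y - x) := by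
  funext y
  simp only [dilateReflect_apply, zero_sub, neg_sub]

theorem dilateReflect_smul (c : ℂ) (φ : TestFn n) (l : ℤ) (x : E n) :
    dilateReflect (c • φ) l x = c • dilateReflect φ l x := by
  ext y
  simp only [dilateReflect_apply, IsSMulApply.smul_apply]
  exact smul_comm _ _ _

/-- This exhibits each value `f φ` as a convolution value at any prescribed point and scale. -/
theorem dilateReflect_dilateReflect_neg (φ : TestFn n) (l : ℤ) (x : E n) :
    dilateReflect (dilateReflect φ (-l) ((2 : ℝ) ^ l • x)) l x = φ := by
  ext y
  have h2 : (2 : ℝ) ^ l ≠ 0 := zpow_ne_zero _ two_ne_zero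
  have h3 : (2 : ℝ) ^ (l * n) ≠ 0 := zpow_ne_zero _ two_ne_zero
  have e : (2 : ℝ) ^ (-l) • ((2 : ℝ) ^ l • x - (2 : ℝ) ^ l • (x - y)) = y := by
    rw [← smul_sub, smul_smul, zpow_neg, inv_mul_cancel₀ h2, one_smul, sub_sub_cancel]
  rw [dilateReflect_apply, dilateReflect_apply, e, smul_smul, neg_mul, zpow_neg,
    mul_inv_cancel₀ h3, one_smul]

theorem norm_iteratedFDeriv_dilateReflect (φ : TestFn n) (l : ℤ) (x y : E n) (k : ℕ) :
    ‖iteratedFDeriv ℝ k (dilateReflect φ l x : E n → ℂ) y‖ =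
      (2 : ℝ) ^ (l * n) * ((2 : ℝ) ^ l) ^ k *
        ‖iteratedFDeriv ℝ k (φ : E n → ℂ) ((2 : ℝ) ^ l • (x - y))‖ := by
  have e : (dilateReflect φ l x : E n → ℂ) =
      fun y => (fun z => (2 : ℝ) ^ (l * n) • (fun w : E n => φ ((-(2 : ℝ) ^ l) • w)) z) (y - x) := by
    funext y
    simp only [dilateReflect_apply]
    rw [neg_smul, ← smul_neg, neg_sub]
  have hφ : ContDiff ℝ k (φ : E n → ℂ) := φ.contDiff.of_le (mod_cast le_top)
  have hφ' : ContDiff ℝ k (fun w : E n => φ ((-(2 : ℝ) ^ l) • w)) :=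
    hφ.comp (contDiff_id.const_smul _)
  rw [e, iteratedFDeriv_comp_sub (f := fun z => (2 : ℝ) ^ (l * n) •
    (fun w : E n => φ ((-(2 : ℝ) ^ l) • w)) z),
    iteratedFDeriv_const_smul_apply' hφ'.contDiffAt, iteratedFDeriv_comp_const_smul _ hφ,
    norm_smul, norm_smul, neg_smul, ← smul_neg, neg_sub, ← mul_assoc]
  simp

/-! ### Measurability of the grand maximal function -/

/-- For `x` near `x₀` the translates share one compact support `K`, and each derivative is a
translate of a single uniformly continuous function; so they vary continuously in `𝓓_K`. -/
theorem continuous_convAt (f : Distr n) (φ : TestFn n) (l : ℤ) :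
    Continuous (convAt f φ l) := by
  rw [continuous_iff_continuousAt]
  intro x₀
  obtain ⟨r, hr⟩ := (dilateReflect φ l 0).hasCompactSupport.isBounded.subset_closedBall 0
  let K : Compacts (E n) := ⟨closedBall x₀ (r + 1), isCompact_closedBall _ _⟩
  have hsupp (x : ball x₀ 1) : Function.support (dilateReflect φ l x : E n → ℂ) ⊆ K := by
    intro y hy
    rw [Function.mem_support, dilateReflect_eq_translate] at hy
    have h1 := hr (subset_tsupport _ hy)
    rw [mem_closedBall, dist_zero_right, ← dist_eq_norm] at h1
    have h2 := mem_ball.1 x.2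
    exact mem_closedBall.2 ((dist_triangle y x x₀).trans (by linarith))
  let Φ : ball x₀ 1 → 𝓓^{⊤}_{K}(E n, ℂ) := fun x =>
    .of_support_subset (dilateReflect φ l x).contDiff (hsupp x)
  have hΦ : Continuous Φ := by
    rw [ContDiffMapSupportedIn.continuous_iff_comp]
    intro i
    set G := iteratedFDeriv ℝ i (dilateReflect φ l 0 : E n → ℂ) with hG
    have hGc : Continuous G :=
      (dilateReflect φ l 0).contDiff.continuous_iteratedFDeriv (mod_cast le_top)
    have hGu : UniformContinuous G :=
      ((dilateReflect φ l 0).hasCompactSupport.iteratedFDeriv i).uniformContinuous_of_continuous hGc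
    have happ (x : ball x₀ 1) (y : E n) :
        ContDiffMapSupportedIn.structureMapCLM ℝ ⊤ i (Φ x) y = G (y - x) := by
      rw [ContDiffMapSupportedIn.structureMapCLM_top_apply]
      change iteratedFDeriv ℝ i (dilateReflect φ l x : E n → ℂ) y = _
      rw [dilateReflect_eq_translate, iteratedFDeriv_comp_sub]
    rw [Metric.continuous_iff]
    intro x ε hε
    obtain ⟨δ, hδ, h⟩ := Metric.uniformContinuous_iff.1 hGu (ε / 2) (half_pos hε)
    refine ⟨δ, hδ, fun y hy => ?_⟩
    refine ((BoundedContinuousFunction.dist_le (half_pos hε).le).2 fun z => ?_).trans_lt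
      (half_lt_self hε)
    rw [Function.comp_apply, Function.comp_apply, happ, happ]
    refine (h ?_).le
    rw [dist_sub_left]
    exact hy
  have hc : Continuous fun x : ball x₀ 1 => convAt f φ l x :=
    f.continuous.comp ((TestFunction.continuous_ofSupportedIn (Ω := ⊤) (K := K)
      (fun _ _ => trivial)).comp hΦ)
  exact (continuousOn_iff_continuous_domRestrict.2 hc).continuousAt (ball_mem_nhds x₀ one_pos)

/-- The condition `2^{-l} < ρ x` is open in `x`, so a nearly optimal pair `(l, φ)` stays admissible
nearby. This yields Borel measurability despite the uncountable supremum. -/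
theorem lowerSemicontinuous_grandMaximal {ρ : E n → ℝ} (hρ : Continuous ρ) (N : ℕ) (R : ℝ)
    (f : Distr n) : LowerSemicontinuous (grandMaximal ρ N R f) := by
  intro x y hy
  simp only [grandMaximal, lt_iSup_iff] at hy
  obtain ⟨l, hl, φ, hφ, h⟩ := hy
  filter_upwards [hρ.continuousAt.eventually (lt_mem_nhds hl),
    (continuous_convAt f φ l).enorm.continuousAt.eventually (lt_mem_nhds h)] with z hz1 hz2
  simp only [grandMaximal, lt_iSup_iff]
  exact ⟨l, hz1, φ, hφ, hz2⟩

theorem enorm_convAt_le_grandMaximal {ρ : E n → ℝ} {N : ℕ} {R : ℝ} (f : Distr n) {x : E n}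
    {l : ℤ} (hl : (2 : ℝ) ^ (-l) < ρ x) {φ : TestFn n} (hφ : φ ∈ testClass n N R) :
    ‖convAt f φ l x‖ₑ ≤ grandMaximal ρ N R f x :=
  le_iSup_of_le l <| le_iSup_of_le hl <| le_iSup_of_le φ <| le_iSup_of_le hφ le_rfl

/-! ### Distributions are controlled by the grand maximal function -/

theorem enorm_apply_le_grandMaximal {ρ : E n → ℝ} {N : ℕ} {R : ℝ} (hR : 1 < R) {x : E n}
    {l : ℤ} (hl : (2 : ℝ) ^ (-l) < ρ x) {φ : TestFn n}
    (hsupp : tsupport (φ : E n → ℂ) ⊆ closedBall x ((2 : ℝ) ^ (-l))) {M : ℝ}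
    (hM : ∀ k ≤ N, ∀ y, ‖iteratedFDeriv ℝ k (φ : E n → ℂ) y‖ ≤ M) (f : Distr n) :
    ‖f φ‖ₑ ≤ ENNReal.ofReal ((2 : ℝ) ^ (-l * n) * max 1 ((2 : ℝ) ^ (-l)) ^ N * M) *
      grandMaximal ρ N R f x := by
  have hM0 : 0 ≤ M := (norm_nonneg _).trans (hM 0 N.zero_le 0)
  -- The normalisation below divides by a multiple of `M`.
  rcases hM0.eq_or_lt with rfl | hM0
  · have : φ = 0 := by
      ext y
      have := hM 0 N.zero_le y
      rw [norm_iteratedFDeriv_zero] at this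
      exact norm_le_zero_iff.1 this
    simp [this]
  -- Rescaling multiplies a `k`-th derivative by `2^{-ln} 2^{-lk}`; the maximum with `1` makes the
  -- bound uniform in `k ≤ N` for either sign of `l`.
  set A : ℝ := (2 : ℝ) ^ (-l * n) * max 1 ((2 : ℝ) ^ (-l)) ^ N * M with hA
  have h2 : (0 : ℝ) < 2 ^ (-l) := zpow_pos two_pos _
  have hA0 : 0 < A := by positivity
  set ψ : TestFn n := dilateReflect φ (-l) ((2 : ℝ) ^ l • x) with hψ
  have hψb (k : ℕ) (hk : k ≤ N) (y : E n) : ‖iteratedFDeriv ℝ k (ψ : E n → ℂ) y‖ ≤ A := by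
    rw [hψ, norm_iteratedFDeriv_dilateReflect, hA]
    gcongr
    · calc ((2 : ℝ) ^ (-l)) ^ k ≤ max 1 ((2 : ℝ) ^ (-l)) ^ k := by gcongr; exact le_max_right _ _
        _ ≤ max 1 ((2 : ℝ) ^ (-l)) ^ N := pow_le_pow_right₀ (le_max_left _ _) hk
    · exact hM k hk _
  have hψs : tsupport (ψ : E n → ℂ) ⊆ closedBall 0 1 := by
    refine closure_minimal (fun z hz => ?_) isClosed_closedBall
    have hz' : φ ((2 : ℝ) ^ (-l) • ((2 : ℝ) ^ l • x - z)) ≠ 0 := fun h => hz <| by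
      rw [hψ, dilateReflect_apply, h, smul_zero]
    have h := hsupp (subset_tsupport _ hz')
    rw [mem_closedBall, dist_eq_norm, smul_sub, smul_smul, ← zpow_add₀ two_ne_zero,
      neg_add_cancel, zpow_zero, one_smul, sub_sub_cancel_left, norm_neg, norm_smul,
      Real.norm_of_nonneg h2.le] at h
    rw [mem_closedBall, dist_zero_right]
    exact le_of_mul_le_mul_left (h.trans_eq (mul_one _).symm) h2
  have hmem : ((A : ℂ)⁻¹ • ψ) ∈ testClass n N R := by
    constructor
    · exact (tsupport_smul_subset_right (fun _ => (A : ℂ)⁻¹) ψ).trans (hψs.trans (closedBall_subset_ball hR))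
    · intro k hk s y
      change ‖iteratedFDeriv ℝ k ((A : ℂ)⁻¹ • (ψ : E n → ℂ)) y _‖ ≤ 1
      have hψc : ContDiff ℝ k (ψ : E n → ℂ) := ψ.contDiff.of_le (mod_cast le_top)
      rw [iteratedFDeriv_const_smul_apply hψc.contDiffAt]
      refine (ContinuousMultilinearMap.le_opNorm _ _).trans ?_
      simp only [PiLp.norm_single, norm_one, Finset.prod_const_one, mul_one]
      rw [norm_smul, norm_inv, Complex.norm_real, Real.norm_of_nonneg hA0.le]
      calc A⁻¹ * _ ≤ A⁻¹ * A := by gcongr; exact hψb k hk y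
        _ = 1 := inv_mul_cancel₀ hA0.ne'
  have hconv : convAt f ((A : ℂ)⁻¹ • ψ) l x = (A : ℂ)⁻¹ * f φ := by
    rw [convAt, dilateReflect_smul, hψ, dilateReflect_dilateReflect_neg, map_smul, smul_eq_mul]
  have hAC : (A : ℂ) ≠ 0 := Complex.ofReal_ne_zero.2 hA0.ne'
  calc ‖f φ‖ₑ = ‖(A : ℂ) * convAt f ((A : ℂ)⁻¹ • ψ) l x‖ₑ := by
        rw [hconv, mul_inv_cancel_left₀ hAC]
    _ = ENNReal.ofReal A * ‖convAt f ((A : ℂ)⁻¹ • ψ) l x‖ₑ := by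
        rw [enorm_mul, ← ofReal_norm (A : ℂ), Complex.norm_real, Real.norm_of_nonneg hA0.le]
    _ ≤ _ := by gcongr; exact enorm_convAt_le_grandMaximal f hl hmem

theorem IsWeight.setLIntegral_ball_ne_zero {ω : E n → ℝ} (hω : IsWeight ω) (a : E n) {s : ℝ}
    (hs : 0 < s) : ∫⁻ x in ball a s, ENNReal.ofReal (ω x) ≠ 0 := by
  have hm : AEMeasurable (fun x => ENNReal.ofReal (ω x)) (volume.restrict (ball a s)) :=
    hω.locallyIntegrable.aestronglyMeasurable.aemeasurable.ennreal_ofReal.restrict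
  rw [Ne, lintegral_eq_zero_iff' hm]
  intro h
  have hf : ∀ᵐ x ∂(volume.restrict (ball a s)), False := by
    filter_upwards [h, ae_restrict_of_ae hω.pos] with x hx hx'
    exact (ENNReal.ofReal_pos.2 hx').ne' hx
  rw [eventually_false_iff_eq_bot, ae_eq_bot, Measure.restrict_eq_zero] at hf
  exact (measure_ball_pos volume a hs).ne' hf

theorem IsWeight.setLIntegral_ball_ne_top {ω : E n → ℝ} (hω : IsWeight ω) (a : E n) (s : ℝ) :
    ∫⁻ x in ball a s, ENNReal.ofReal (ω x) ≠ ∞ :=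
  ((hω.locallyIntegrable.integrableOn_isCompact (isCompact_closedBall a s)).mono_set
    ball_subset_closedBall).lintegral_lt_top.ne

theorem exists_local_bound {ρ ω : E n → ℝ} (hρc : Continuous ρ) (hρ0 : ∀ x, 0 < ρ x)
    (hω : IsWeight ω) {p : ℝ} (hp : 0 < p) (N : ℕ) {R : ℝ} (hR : 1 < R) (a : E n) :
    ∃ s : ℝ, 0 < s ∧ ∃ C : ℝ, 0 ≤ C ∧ ∀ φ : TestFn n, tsupport (φ : E n → ℂ) ⊆ ball a s →
      ∀ M : ℝ, (∀ k ≤ N, ∀ y, ‖iteratedFDeriv ℝ k (φ : E n → ℂ) y‖ ≤ M) →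
      ∀ f : Distr n, ‖f φ‖ₑ ≤ ENNReal.ofReal (C * M) * hardyNorm ρ ω p N R f := by
  obtain ⟨δ, hδ, hδρ⟩ := Metric.eventually_nhds_iff_ball.1
    (hρc.continuousAt.eventually (lt_mem_nhds (half_lt_self (hρ0 a))))
  obtain ⟨m, hm⟩ := exists_pow_lt_of_lt_one (half_pos (hρ0 a)) (one_half_lt_one (α := ℝ))
  set l : ℤ := (m : ℤ)
  have hl : (2 : ℝ) ^ (-l) < ρ a / 2 := by
    rw [zpow_neg, zpow_natCast, ← inv_pow, ← one_div]; exact hm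
  have h2 : (0 : ℝ) < 2 ^ (-l) := zpow_pos two_pos _
  -- Any two points of `ball a s` are within `2^{-l}`, and `ρ > ρ a / 2 > 2^{-l}` on it, so every
  -- point of the ball can serve as `x`.
  set s := min δ ((2 : ℝ) ^ (-l) / 2) with hs
  have hs0 : 0 < s := lt_min hδ (half_pos h2)
  set W := ∫⁻ x in ball a s, ENNReal.ofReal (ω x) with hW
  have hW0 : W ^ (1 / p) ≠ 0 := by
    rw [Ne, ENNReal.rpow_eq_zero_iff]
    simp [hω.setLIntegral_ball_ne_zero a hs0, hω.setLIntegral_ball_ne_top a s, W]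
  have hWt : W ^ (1 / p) ≠ ∞ :=
    ENNReal.rpow_ne_top_of_nonneg (by positivity) (hω.setLIntegral_ball_ne_top a s)
  set D : ℝ := (2 : ℝ) ^ (-l * n) * max 1 ((2 : ℝ) ^ (-l)) ^ N with hD
  have hD0 : 0 ≤ D := by positivity
  refine ⟨s, hs0, D * ((W ^ (1 / p))⁻¹).toReal, by positivity, fun φ hφ M hM f => ?_⟩
  have hpt (x : E n) (hx : x ∈ ball a s) :
      ‖f φ‖ₑ ≤ ENNReal.ofReal (D * M) * grandMaximal ρ N R f x := by
    have hxs := mem_ball.1 hx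
    refine enorm_apply_le_grandMaximal hR (l := l)
      (hl.trans (hδρ x (ball_subset_ball (min_le_left _ _) hx))) (fun y hy => ?_) hM f
    have hys := mem_ball.1 (hφ hy)
    have := dist_triangle_right y x a
    have := min_le_right δ ((2 : ℝ) ^ (-l) / 2)
    exact mem_closedBall.2 (by linarith)
  -- The left side of `hpt` does not depend on `x`; its `p`-th power is integrated against `ω` over
  -- the ball.
  have hint : ‖f φ‖ₑ ^ p * W ≤ ENNReal.ofReal (D * M) ^ p *
      ∫⁻ x, grandMaximal ρ N R f x ^ p * ENNReal.ofReal (ω x) := by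
    rw [hW, ← lintegral_const_mul' _ _ (ENNReal.rpow_ne_top_of_nonneg hp.le enorm_ne_top),
      ← lintegral_const_mul' _ _ (ENNReal.rpow_ne_top_of_nonneg hp.le ENNReal.ofReal_ne_top)]
    refine (setLIntegral_mono' measurableSet_ball fun x hx => ?_).trans (setLIntegral_le_lintegral _ _)
    rw [← mul_assoc, ← ENNReal.mul_rpow_of_nonneg _ _ hp.le]
    gcongr
    exact hpt x hx
  have hroot := ENNReal.rpow_le_rpow hint (one_div_pos.2 hp).le
  rw [ENNReal.mul_rpow_of_nonneg _ _ (one_div_pos.2 hp).le,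
    ENNReal.mul_rpow_of_nonneg _ _ (one_div_pos.2 hp).le, ← ENNReal.rpow_mul, ← ENNReal.rpow_mul,
    mul_one_div_cancel hp.ne', ENNReal.rpow_one, ENNReal.rpow_one] at hroot
  rw [mul_right_comm, ENNReal.ofReal_mul' ENNReal.toReal_nonneg,
    ENNReal.ofReal_toReal (ENNReal.inv_ne_top.2 hW0), mul_right_comm, ← div_eq_mul_inv]
  exact (ENNReal.le_div_iff_mul_le (.inl hW0) (.inl hWt)).2 hroot

/-! ### From small balls to compact sets -/

theorem exists_finite_smooth_decomposition (K : Compacts (E n)) (s : E n → ℝ)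
    (hs : ∀ a, 0 < s a) :
    ∃ (t : Finset (E n)) (χ : E n → E n → ℂ), (∀ a, ContDiff ℝ (⊤ : ℕ∞) (χ a)) ∧
      (∀ a, tsupport (χ a) ⊆ ball a (s a)) ∧ ∀ x ∈ K, ∑ a ∈ t, χ a x = 1 := by
  obtain ⟨t, -, ht⟩ := K.isCompact.elim_nhds_subcover (fun a => ball a (s a))
    fun a _ => ball_mem_nhds a (hs a)
  obtain ⟨χ, hχ⟩ := SmoothPartitionOfUnity.exists_isSubordinate (modelWithCornersSelf ℝ (E n))
    K.isCompact.isClosed (fun a : t => ball (a : E n) (s a)) (fun _ => isOpen_ball)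
    (fun x hx => by simpa using ht hx)
  classical
  refine ⟨t, fun a x => if h : a ∈ t then ((χ ⟨a, h⟩ x : ℝ) : ℂ) else 0, fun a => ?_,
    fun a => ?_, fun x hx => ?_⟩
  · by_cases h : a ∈ t
    · simp only [h, dite_true]
      exact Complex.ofRealCLM.contDiff.comp (χ ⟨a, h⟩).contMDiff.contDiff
    · simpa only [h, dite_false] using contDiff_const
  · by_cases h : a ∈ t
    · simp only [h, dite_true]
      exact (tsupport_comp_subset Complex.ofReal_zero (χ ⟨a, h⟩)).trans (hχ ⟨a, h⟩)
    · simp only [h, dite_false]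
      change tsupport (0 : E n → ℂ) ⊆ _
      simp
  · rw [← Finset.sum_coe_sort]
    have h1 := χ.sum_eq_one hx
    rw [finsum_eq_sum_of_fintype] at h1
    simp only [Finset.coe_mem, dite_true, Subtype.coe_eta]
    exact_mod_cast h1

/-- The bound `q` is independent of `f`; its continuity and `q 0 = 0` later make the limit
functional continuous. -/
theorem exists_continuous_bound {ρ ω : E n → ℝ} (hρc : Continuous ρ) (hρ0 : ∀ x, 0 < ρ x)
    (hω : IsWeight ω) {p : ℝ} (hp : 0 < p) (N : ℕ) {R : ℝ} (hR : 1 < R) (K : Compacts (E n))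
    (hK : (K : Set (E n)) ⊆ (⊤ : Opens (E n))) :
    ∃ q : 𝓓^{⊤}_{K}(E n, ℂ) → ℝ, Continuous q ∧ q 0 = 0 ∧ ∀ (φ : 𝓓^{⊤}_{K}(E n, ℂ)) (f : Distr n),
      ‖f (TestFunction.ofSupportedIn hK φ)‖ₑ ≤ ENNReal.ofReal (q φ) * hardyNorm ρ ω p N R f := by
  choose s hs C hC h using exists_local_bound hρc hρ0 hω hp N hR
  obtain ⟨t, χ, hχ, hχs, hχ1⟩ := exists_finite_smooth_decomposition K s hs
  let T (a : E n) : 𝓓^{⊤}_{K}(E n, ℂ) →L[ℂ] 𝓓^{⊤}_{K}(E n, ℂ) :=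
    ContDiffMapSupportedIn.bilinLeftCLM (ContinuousLinearMap.mul ℂ ℂ) (hχ a)
  let P (k : ℕ) : Seminorm ℝ 𝓓^{⊤}_{K}(E n, ℂ) := ContDiffMapSupportedIn.seminorm ℝ _ _ ⊤ K k
  have hP (k : ℕ) : Continuous (P k) :=
    (ContDiffMapSupportedIn.withSeminorms ℝ _ _ ⊤ K).continuous_seminorm k
  -- A sum of seminorms dominates each one of order at most `N`, so it serves as `M` in the local
  -- bound for `φ χ_a`.
  let S (a : E n) (φ : 𝓓^{⊤}_{K}(E n, ℂ)) : ℝ := ∑ k ∈ Finset.range (N + 1), P k (T a φ)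
  have hSc (a : E n) : Continuous (S a) :=
    continuous_finsetSum _ fun k _ => (hP k).comp (T a).continuous
  have hS0 (a : E n) : S a 0 = 0 := Finset.sum_eq_zero fun k _ => by
    rw [map_zero (T a), map_zero]
  have hSnonneg (a : E n) (φ : 𝓓^{⊤}_{K}(E n, ℂ)) : 0 ≤ S a φ :=
    Finset.sum_nonneg fun k _ => apply_nonneg (P k) _
  refine ⟨fun φ => ∑ a ∈ t, C a * S a φ,
    continuous_finsetSum _ fun a _ => continuous_const.mul (hSc a),
    Finset.sum_eq_zero fun a _ => by rw [hS0, mul_zero], fun φ f => ?_⟩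
  have hsum : TestFunction.ofSupportedIn hK φ =
      ∑ a ∈ t, TestFunction.ofSupportedIn hK (T a φ) := by
    ext x
    rw [FunLike.coe_sum, Finset.sum_apply]
    change φ x = ∑ a ∈ t, φ x * χ a x
    rw [← Finset.mul_sum]
    by_cases hx : x ∈ K
    · rw [hχ1 x hx, mul_one]
    · rw [show φ x = 0 from φ.zero_on_compl hx, zero_mul]
  have hpart (a : E n) : ‖f (TestFunction.ofSupportedIn hK (T a φ))‖ₑ ≤
      ENNReal.ofReal (C a * S a φ) * hardyNorm ρ ω p N R f := by
    refine h a _ ?_ _ (fun k hk y => ?_) f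
    · exact (tsupport_mul_subset_right (f := φ) (g := χ a)).trans (hχs a)
    · refine (ContDiffMapSupportedIn.norm_iteratedFDeriv_apply_le_seminorm_top ℝ
        (f := T a φ)).trans ?_
      exact Finset.single_le_sum (f := fun k => P k (T a φ)) (fun k _ => apply_nonneg (P k) _)
        (Finset.mem_range_succ_iff.2 hk)
  dsimp only
  rw [hsum, map_sum, ENNReal.ofReal_sum_of_nonneg (fun a _ => mul_nonneg (hC a) (hSnonneg a φ)),
    Finset.sum_mul]
  exact (enorm_sum_le _ _).trans (Finset.sum_le_sum fun a _ => hpart a)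

/-! ### Convergence of distributions and the Hardy quasi-norm -/

theorem grandMaximal_add_le (ρ : E n → ℝ) (N : ℕ) (R : ℝ) (f g : Distr n) (x : E n) :
    grandMaximal ρ N R (f + g) x ≤ grandMaximal ρ N R f x + grandMaximal ρ N R g x := by
  refine iSup_le fun l => iSup_le fun hl => iSup_le fun φ => iSup_le fun hφ => ?_
  exact (enorm_add_le _ _).trans (add_le_add (enorm_convAt_le_grandMaximal f hl hφ)
    (enorm_convAt_le_grandMaximal g hl hφ))

theorem grandMaximal_le_liminf (ρ : E n → ℝ) (N : ℕ) (R : ℝ) {u : ℕ → Distr n} {v : Distr n}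
    (huv : ∀ φ, Tendsto (fun i => u i φ) atTop (𝓝 (v φ))) (x : E n) :
    grandMaximal ρ N R v x ≤ liminf (fun i => grandMaximal ρ N R (u i) x) atTop := by
  refine iSup_le fun l => iSup_le fun hl => iSup_le fun φ => iSup_le fun hφ => ?_
  rw [convAt, ← (huv _).enorm.liminf_eq]
  exact liminf_le_liminf (.of_forall fun i => enorm_convAt_le_grandMaximal (u i) hl hφ)

theorem aemeasurable_grandMaximal_rpow_mul {ρ ω : E n → ℝ} (hρ : Continuous ρ) (hω : IsWeight ω)
    (p : ℝ) (N : ℕ) (R : ℝ) (f : Distr n) :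
    AEMeasurable fun x => grandMaximal ρ N R f x ^ p * ENNReal.ofReal (ω x) :=
  ((lowerSemicontinuous_grandMaximal hρ N R f).measurable.pow_const p).aemeasurable.mul
    hω.locallyIntegrable.aestronglyMeasurable.aemeasurable.ennreal_ofReal

theorem hardyNorm_le_iff {ρ ω : E n → ℝ} {p : ℝ} (hp : 0 < p) {N : ℕ} {R : ℝ} {f : Distr n}
    {ε : ℝ≥0∞} : hardyNorm ρ ω p N R f ≤ ε ↔
      ∫⁻ x, grandMaximal ρ N R f x ^ p * ENNReal.ofReal (ω x) ≤ ε ^ p := by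
  rw [hardyNorm, weightedLpNorm, one_div, ENNReal.rpow_inv_le_iff hp]

theorem hardyNorm_lt_top_iff {ρ ω : E n → ℝ} {p : ℝ} (hp : 0 < p) {N : ℕ} {R : ℝ} {f : Distr n} :
    hardyNorm ρ ω p N R f < ∞ ↔
      ∫⁻ x, grandMaximal ρ N R f x ^ p * ENNReal.ofReal (ω x) < ∞ :=
  ENNReal.rpow_lt_top_iff_of_pos (one_div_pos.2 hp)

/-- Fatou's lemma, applied to the pointwise bound `grandMaximal_le_liminf`. -/
theorem hardyNorm_le_of_tendsto {ρ ω : E n → ℝ} (hρ : Continuous ρ) (hω : IsWeight ω) {p : ℝ}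
    (hp : 0 < p) {N : ℕ} {R : ℝ} {u : ℕ → Distr n} {v : Distr n}
    (huv : ∀ φ, Tendsto (fun i => u i φ) atTop (𝓝 (v φ))) {ε : ℝ≥0∞}
    (hu : ∀ᶠ i in atTop, hardyNorm ρ ω p N R (u i) ≤ ε) : hardyNorm ρ ω p N R v ≤ ε := by
  rw [hardyNorm_le_iff hp]
  calc ∫⁻ x, grandMaximal ρ N R v x ^ p * ENNReal.ofReal (ω x)
      ≤ ∫⁻ x, liminf (fun i => grandMaximal ρ N R (u i) x ^ p * ENNReal.ofReal (ω x)) atTop := by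
        refine lintegral_mono fun x => ?_
        have hmono : Monotone fun z : ℝ≥0∞ => z ^ p * ENNReal.ofReal (ω x) := fun a b hab => by
          dsimp only; gcongr
        have hcont : Continuous fun z : ℝ≥0∞ => z ^ p * ENNReal.ofReal (ω x) :=
          (ENNReal.continuous_mul_const ENNReal.ofReal_ne_top).comp ENNReal.continuous_rpow_const
        exact (hmono (grandMaximal_le_liminf ρ N R huv x)).trans_eq
          (hmono.map_liminf_of_continuousAt _ hcont.continuousAt)
    _ ≤ liminf (fun i => ∫⁻ x, grandMaximal ρ N R (u i) x ^ p * ENNReal.ofReal (ω x)) atTop :=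
        lintegral_liminf_le' fun i => aemeasurable_grandMaximal_rpow_mul hρ hω p N R (u i)
    _ ≤ ε ^ p := liminf_le_of_frequently_le'
        (hu.mono fun i hi => (hardyNorm_le_iff hp).1 hi).frequently

theorem hardyNorm_add_lt_top {ρ ω : E n → ℝ} (hρ : Continuous ρ) (hω : IsWeight ω) {p : ℝ}
    (hp : 0 < p) (hp1 : p ≤ 1) {N : ℕ} {R : ℝ} {f g : Distr n}
    (hf : hardyNorm ρ ω p N R f < ∞) (hg : hardyNorm ρ ω p N R g < ∞) :
    hardyNorm ρ ω p N R (f + g) < ∞ := by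
  rw [hardyNorm_lt_top_iff hp] at *
  refine lt_of_le_of_lt ?_ (ENNReal.add_lt_top.2 ⟨hf, hg⟩)
  rw [← lintegral_add_left' (aemeasurable_grandMaximal_rpow_mul hρ hω p N R f)]
  refine lintegral_mono fun x => ?_
  dsimp only
  rw [← add_mul]
  gcongr
  exact (ENNReal.rpow_le_rpow (grandMaximal_add_le ρ N R f g x) hp.le).trans
    (ENNReal.rpow_add_le_add_rpow _ _ hp.le hp1)

theorem exists_tendsto_distr {ρ ω : E n → ℝ} (hρc : Continuous ρ) (hρ0 : ∀ x, 0 < ρ x)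
    (hω : IsWeight ω) {p : ℝ} (hp : 0 < p) (N : ℕ) {R : ℝ} (hR : 1 < R) {f : ℕ → Distr n}
    (hf : ∀ ε : ℝ≥0∞, 0 < ε → ∃ J : ℕ, ∀ i j : ℕ, J ≤ i → J ≤ j →
      hardyNorm ρ ω p N R (f i - f j) < ε) :
    ∃ g : Distr n, ∀ φ, Tendsto (fun i => f i φ) atTop (𝓝 (g φ)) := by
  have htop (K : Compacts (E n)) : (K : Set (E n)) ⊆ (⊤ : Opens (E n)) := fun _ _ => trivial
  have hlim (φ : TestFn n) : ∃ z, Tendsto (fun i => f i φ) atTop (𝓝 z) := by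
    let K : Compacts (E n) := ⟨tsupport φ, φ.hasCompactSupport⟩
    obtain ⟨q, -, -, hq⟩ := exists_continuous_bound hρc hρ0 hω hp N hR K (htop K)
    let φK : 𝓓^{⊤}_{K}(E n, ℂ) := .of_support_subset φ.contDiff subset_closure
    refine cauchySeq_tendsto_of_complete (EMetric.cauchySeq_iff.2 fun ε hε => ?_)
    -- Adding `1` keeps the divisor positive.
    obtain ⟨J, hJ⟩ := hf (ε / ENNReal.ofReal (|q φK| + 1))
      (ENNReal.div_pos hε.ne' ENNReal.ofReal_ne_top)
    refine ⟨J, fun i hi j hj => ?_⟩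
    have hpos : 0 < |q φK| + 1 := by positivity
    calc edist (f i φ) (f j φ) = ‖(f i - f j) (TestFunction.ofSupportedIn (htop K) φK)‖ₑ := by
          rw [edist_eq_enorm_sub]; rfl
      _ ≤ ENNReal.ofReal (q φK) * hardyNorm ρ ω p N R (f i - f j) := hq φK _
      _ ≤ ENNReal.ofReal (|q φK| + 1) * hardyNorm ρ ω p N R (f i - f j) := by
          gcongr; linarith [le_abs_self (q φK)]
      _ < ε := by
          rw [mul_comm]
          exact (ENNReal.lt_div_iff_mul_lt (.inl (ENNReal.ofReal_pos.2 hpos).ne')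
            (.inl ENNReal.ofReal_ne_top)).1 (hJ i j hi hj)
  choose G hG using hlim
  have hadd (φ ψ : TestFn n) : G (φ + ψ) = G φ + G ψ :=
    tendsto_nhds_unique (hG _) (by simpa only [map_add] using (hG φ).add (hG ψ))
  have hsmul (c : ℂ) (φ : TestFn n) : G (c • φ) = c • G φ :=
    tendsto_nhds_unique (hG _) (by simpa only [map_smul] using (hG φ).const_smul c)
  obtain ⟨J, hJ⟩ := hf 1 one_pos
  refine ⟨TestFunction.mkCLM ℂ G hadd hsmul fun K hK => ?_, hG⟩
  obtain ⟨q, hqc, hq0, hq⟩ := exists_continuous_bound hρc hρ0 hω hp N hR K hK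
  -- As `f J` is continuous, it suffices to treat `G - f J`, which is bounded by `q` because the
  -- quasi-norms of `f i - f J` are below `1`; by additivity, continuity at `0` is enough.
  let D : 𝓓^{⊤}_{K}(E n, ℂ) →+ ℂ := AddMonoidHom.mk'
    (fun φ => G (TestFunction.ofSupportedIn hK φ) - f J (TestFunction.ofSupportedIn hK φ))
    fun φ ψ => by
      have e : TestFunction.ofSupportedIn hK (φ + ψ) = TestFunction.ofSupportedIn (Ω := ⊤) hK φ +
        TestFunction.ofSupportedIn hK ψ := rfl
      rw [e, hadd, map_add]
      ring
  have hD (φ : 𝓓^{⊤}_{K}(E n, ℂ)) : ‖D φ‖ₑ ≤ ENNReal.ofReal (q φ) := by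
    refine le_of_tendsto ((hG _).sub_const _).enorm ?_
    filter_upwards [eventually_ge_atTop J] with i hi
    exact (hq φ (f i - f J)).trans (mul_le_of_le_one_right' (hJ i J hi le_rfl).le)
  have hDc : Continuous D := by
    refine continuous_of_continuousAt_zero D ?_
    rw [ContinuousAt, map_zero, tendsto_zero_iff_enorm_tendsto_zero]
    have hq' : Tendsto (fun φ => ENNReal.ofReal (q φ)) (𝓝 0) (𝓝 0) := by
      simpa [hq0, Function.comp_def] using (ENNReal.continuous_ofReal.comp hqc).tendsto 0
    exact tendsto_of_tendsto_of_tendsto_of_le_of_le tendsto_const_nhds hq' (fun _ => zero_le) hD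
  refine (hDc.add ((f J).continuous.comp (TestFunction.continuous_ofSupportedIn hK))).congr
    fun φ => ?_
  exact sub_add_cancel _ _

/-! ### Completeness -/

theorem MemAInfty.isWeight {ρ ω : E n → ℝ} (h : MemAInfty ρ ω) : IsWeight ω := by
  obtain ⟨_, _, _, _, ⟨_, h⟩ | ⟨_, h⟩⟩ := h <;> exact h.1

end WeightedLocalHardy

open WeightedLocalHardy in
theorem proposition3p3 (n : ℕ) (hn : 1 ≤ n)
    (ρ : WeightedLocalHardy.E n → ℝ) (hρ : WeightedLocalHardy.IsCriticalRadius ρ)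
    (ω : WeightedLocalHardy.E n → ℝ) (hω : WeightedLocalHardy.MemAInfty ρ ω)
    (p : ℝ) (hp0 : 0 < p) (hp1 : p ≤ 1) (R : ℝ) (hR : 1 < R) (A₀ : ℝ)
    (N : ℕ) (hN : WeightedLocalHardy.orderThreshold ρ ω p A₀ ≤ (N : ℤ))
    (f : ℕ → WeightedLocalHardy.Distr n)
    (hf : ∀ j, f j ∈ WeightedLocalHardy.hardySpace ρ ω p N R)
    (hCauchy : ∀ ε : ℝ≥0∞, 0 < ε → ∃ J : ℕ, ∀ i j : ℕ, J ≤ i → J ≤ j →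
      WeightedLocalHardy.hardyNorm ρ ω p N R (f i - f j) < ε) :
    ∃ g ∈ WeightedLocalHardy.hardySpace ρ ω p N R,
      Tendsto (fun j => WeightedLocalHardy.hardyNorm ρ ω p N R (f j - g)) atTop (𝓝 0) := by
  have hw := hω.isWeight
  obtain ⟨g, hg⟩ := exists_tendsto_distr hρ.continuous hρ.pos hw hp0 N hR hCauchy
  refine ⟨g, ⟨(lowerSemicontinuous_grandMaximal hρ.continuous N R g).measurable.aemeasurable, ?_⟩,
    ?_⟩
  · obtain ⟨J, hJ⟩ := hCauchy 1 one_pos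
    -- Here `J` is fixed and `i → ∞` in `f i - f J`; the convergence claim below uses `f j - f i` in
    -- the same way.
    have hdiff : hardyNorm ρ ω p N R (g - f J) ≤ 1 :=
      hardyNorm_le_of_tendsto hρ.continuous hw hp0 (u := fun i => f i - f J)
        (fun φ => (hg φ).sub_const _)
        (eventually_atTop.2 ⟨J, fun i hi => (hJ i J hi le_rfl).le⟩)
    rw [← add_sub_cancel (f J) g]
    exact hardyNorm_add_lt_top hρ.continuous hw hp0 hp1 (hf J).2
      (hdiff.trans_lt ENNReal.one_lt_top)
  · refine ENNReal.tendsto_nhds_zero.2 fun ε hε => ?_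
    obtain ⟨J, hJ⟩ := hCauchy ε hε
    refine eventually_atTop.2 ⟨J, fun j hj => ?_⟩
    exact hardyNorm_le_of_tendsto hρ.continuous hw hp0 (u := fun i => f j - f i)
      (fun φ => (hg φ).const_sub _) (eventually_atTop.2 ⟨J, fun i hi => (hJ j i hj hi).le⟩)
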